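/- **Theorem 2.3 (Infinite Distorted Embedding Theorem).** A semi-metric space $(X,d)$ is a set $X$ with a function $d:X\times X\to[0,\infty)$ such that $d(x,y)=d(y,x)$, and $d(x,y)=0$ if and only if $x=y$ (the triangle inequality is not required). Let $(X,d)$ be a semi-metric space, $0<p<\infty$ and $1\le C<\infty$. Then the following are equivalent: 1. $X$ has $p$-negative type with distortion $C$, that is, $$\sum_{(i,j)\,:\,q_{ij}>0} d(x_i,x_j)^p\,q_{ij}+C^2\sum_{(i,j)\,:\,q_{ij}<0} d(x_i,x_j)^p\,q_{ij}\le 0$$ for all $n\ge 2$, all distinct $x_1,\dots,x_n\in X$ and all symmetric positive semidefinite real $n\times n$ matrices $Q=(q_{ij})$ with $Q\mathbf 1=0$, where $\mathbf 1=(1,\dots,1)^{T}$. 2. $(X,d^{p/2})$ embeds in some real Hilbert space with distortion at most $C$, that is, there exist a real Hilbert space $H$, a map $f:X\to H$ and a constant $s>0$ such that $$s\,d(x,y)^{p/2}\le\|f(x)-f(y)\|\le s\,C\,d(x,y)^{p/2}\qquad\text{for all }x,y\in X.$$ -/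

import Mathlib

universe u v

/-- A semi-metric on `X`: a metric except that the triangle inequality is not required. -/
structure Semimetric (X : Type*) where
  d : X → X → ℝ
  d_nonneg : ∀ x y, 0 ≤ d x y
  d_eq_zero_iff : ∀ x y, d x y = 0 ↔ x = y
  d_comm : ∀ x y, d x y = d y x

namespace Semimetric

/-- The semi-metric underlying a metric space. -/
def ofMetricSpace (Y : Type*) [MetricSpace Y] : Semimetric Y where
  d := dist
  d_nonneg := fun _ _ => dist_nonneg
  d_eq_zero_iff := fun _ _ => dist_eq_zero
  d_comm := dist_comm

/-- The power `d ^ α` (with `α > 0`) of a semi-metric, again a semi-metric. -/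
noncomputable def rpow {X : Type*} (δ : Semimetric X) (α : ℝ) (hα : 0 < α) : Semimetric X where
  d := fun x y => δ.d x y ^ α
  d_nonneg := fun x y => Real.rpow_nonneg (δ.d_nonneg x y) α
  d_eq_zero_iff := fun x y => by
    rw [Real.rpow_eq_zero (δ.d_nonneg x y) hα.ne', δ.d_eq_zero_iff]
  d_comm := fun x y => by rw [δ.d_comm]

/-- The map `f : (X, δX) → (Y, δY)` has distortion at most `C`. -/
def DistortionAtMost {X Y : Type*} (δX : Semimetric X) (δY : Semimetric Y)
    (f : X → Y) (C : ℝ) : Prop :=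
  ∃ s : ℝ, 0 < s ∧ ∀ x y : X,
    s * δX.d x y ≤ δY.d (f x) (f y) ∧ δY.d (f x) (f y) ≤ s * C * δX.d x y

/-- `(X, δ)` embeds in some (real) Hilbert space with distortion at most `C`. The Hilbert space
may live in any universe at least as large as that of `X`. -/
def EmbedsInHilbert {X : Type u} (δ : Semimetric X) (C : ℝ) : Prop :=
  ∃ (H : Type (max u v)) (_ : NormedAddCommGroup H) (_ : InnerProductSpace ℝ H)
    (_ : CompleteSpace H) (f : X → H), DistortionAtMost δ (ofMetricSpace H) f C

/-- `(X, δ)` has `p`-negative type with distortion `C` (used for `p > 0`). The matrix `Q` ranges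
over the symmetric positive semidefinite real matrices whose rows sum to zero. -/
def HasNegativeType {X : Type*} (δ : Semimetric X) (p C : ℝ) : Prop :=
  ∀ (n : ℕ), 2 ≤ n → ∀ (x : Fin n → X), Function.Injective x →
    ∀ Q : Matrix (Fin n) (Fin n) ℝ, Q.PosSemidef → Q.mulVec (fun _ => 1) = 0 →
      ∑ ij : Fin n × Fin n with 0 < Q ij.1 ij.2, δ.d (x ij.1) (x ij.2) ^ p * Q ij.1 ij.2
        + C ^ 2 *
          ∑ ij : Fin n × Fin n with Q ij.1 ij.2 < 0, δ.d (x ij.1) (x ij.2) ^ p * Q ij.1 ij.2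
      ≤ 0

end Semimetric

open Finset Topology

/-! An embedding gives the inequality because squared Hilbert distances pair nonpositively with `Q`;
the two distortion bounds are applied according to the sign of each entry. Conversely, by
Schoenberg's criterion it suffices to find a kernel of negative type in the box between `d ^ p` and
`C ^ 2 * d ^ p`. In the product topology the box is compact (Tychonoff) and the cone of such kernels
is closed and convex. If they were disjoint, Hahn-Banach would give a functional negative on the box
and nonnegative on the cone. It sees only finitely many points, so it is a finite signed weight
whose Laplacian is positive semidefinite. The hypothesis applied to this Laplacian makes the
functional nonnegative at a corner of the box, a contradiction. -/

/-- A continuous linear functional on a product of copies of `ℝ` depends on finitely many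
coordinates only. -/
lemma StrongDual.exists_finset_sum {ι : Type*} [DecidableEq ι] (φ : StrongDual ℝ (ι → ℝ)) :
    ∃ S : Finset ι, ∀ T, S ⊆ T → ∀ f, φ f = ∑ i ∈ T, φ (Pi.single i 1) * f i := by
  have h0 : {f : ι → ℝ | |φ f| < 1} ∈ 𝓝 (0 : ι → ℝ) := by
    refine (isOpen_lt (by fun_prop) continuous_const).mem_nhds ?_
    simp
  rw [nhds_pi, Filter.mem_pi] at h0
  obtain ⟨I, hI, t, ht, hsub⟩ := h0
  have key : ∀ f : ι → ℝ, (∀ i ∈ I, f i = 0) → φ f = 0 := by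
    intro f hf
    by_contra hne
    -- The rescaled function still vanishes on `I`, but `φ` takes the value 1 on it.
    have hmem : (φ f)⁻¹ • f ∈ {f : ι → ℝ | |φ f| < 1} := by
      refine hsub fun i hi => ?_
      simpa [hf i hi] using mem_of_mem_nhds (ht i)
    simp [hne] at hmem
  refine ⟨hI.toFinset, fun T hT f => ?_⟩
  have h1 := key (f - ∑ i ∈ T, f i • Pi.single i (1 : ℝ)) fun i hi => by
    have hiT : i ∈ T := hT (hI.mem_toFinset.2 hi)
    simp [Finset.sum_apply, Pi.single_apply, hiT]
  rw [map_sub, map_sum, sub_eq_zero] at h1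
  rw [h1]
  exact Finset.sum_congr rfl fun i _ => by rw [map_smul, smul_eq_mul, mul_comm]

/-! ### Laplacians of signed weights -/

/-- The weighted Laplacian of a symmetric weight on a finite type. -/
def weightedLaplacian {ι : Type*} [Fintype ι] [DecidableEq ι] (a : ι → ι → ℝ) :
    Matrix ι ι ℝ :=
  Matrix.of fun i j => (if i = j then ∑ k, a i k else 0) - a i j

section weightedLaplacian

variable {ι : Type*} [Fintype ι] [DecidableEq ι] {a : ι → ι → ℝ}

lemma weightedLaplacian_of_ne {i j : ι} (h : i ≠ j) : weightedLaplacian a i j = -a i j := by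
  simp [weightedLaplacian, h]

lemma weightedLaplacian_mulVec_one : (weightedLaplacian a).mulVec (fun _ => 1) = 0 := by
  ext i
  simp [weightedLaplacian, Matrix.mulVec, dotProduct]

/-- The quadratic form of the Laplacian is half the sum in `h`. Individual weights may be negative.
-/
lemma weightedLaplacian_posSemidef (hs : ∀ i j, a i j = a j i)
    (h : ∀ v : ι → ℝ, 0 ≤ ∑ i, ∑ j, a i j * (v i - v j) ^ 2) :
    (weightedLaplacian a).PosSemidef := by
  refine .of_dotProduct_mulVec_nonneg ?_ fun v => ?_
  · ext i j
    by_cases hij : i = j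
    · subst hij; simp
    · simp [weightedLaplacian_of_ne hij, weightedLaplacian_of_ne (Ne.symm hij), hs i j]
  · have e1 : star v ⬝ᵥ (weightedLaplacian a).mulVec v
        = (∑ i, ∑ j, a i j * v i ^ 2) - ∑ i, ∑ j, a i j * (v i * v j) := by
      simp only [dotProduct, Matrix.mulVec, weightedLaplacian, Matrix.of_apply, sub_mul, ite_mul,
        zero_mul, Finset.sum_sub_distrib, Finset.sum_ite_eq, Finset.mem_univ, if_true,
        star_trivial, mul_sub, Finset.mul_sum, Finset.sum_mul]
      congr 1 <;> refine sum_congr rfl fun i _ => sum_congr rfl fun j _ => by ring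
    have e2 : ∑ i, ∑ j, a i j * v j ^ 2 = ∑ i, ∑ j, a i j * v i ^ 2 := by
      rw [Finset.sum_comm]
      exact sum_congr rfl fun i _ => sum_congr rfl fun j _ => by rw [hs]
    have e3 : ∑ i, ∑ j, a i j * (v i - v j) ^ 2 = (∑ i, ∑ j, a i j * v i ^ 2)
        + (∑ i, ∑ j, a i j * v j ^ 2) - 2 * ∑ i, ∑ j, a i j * (v i * v j) := by
      simp only [Finset.mul_sum, ← Finset.sum_add_distrib, ← Finset.sum_sub_distrib]
      exact sum_congr rfl fun i _ => sum_congr rfl fun j _ => by ring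
    have := h v
    rw [e1]
    linarith

end weightedLaplacian

/-! ### Hilbert spaces from kernels -/

/-- A positive semidefinite real kernel is the Gram kernel of a family in a Hilbert space. -/
lemma exists_hilbert_inner_eq {Y : Type u} (k : Y → Y → ℝ) (hs : ∀ x y, k x y = k y x)
    (hk : ∀ c : Y →₀ ℝ, 0 ≤ c.sum fun x a => c.sum fun y b => a * b * k x y) :
    ∃ (H : Type u) (_ : NormedAddCommGroup H) (_ : InnerProductSpace ℝ H)
      (_ : CompleteSpace H) (f : Y → H), ∀ x y, inner ℝ (f x) (f y) = k x y := by
  -- Each scalar acts as an operator on `ℝ`, which turns `k` into an operator-valued reproducing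
  -- kernel.
  let K : Matrix Y Y (ℝ →L[ℝ] ℝ) := Matrix.of fun x y => k x y • ContinuousLinearMap.id ℝ ℝ
  have hH : K.IsHermitian := by
    ext x y
    change (star (k y x • (1 : ℝ →L[ℝ] ℝ))) 1 = (k x y • (1 : ℝ →L[ℝ] ℝ)) 1
    rw [star_smul, star_one, star_trivial, hs y x]
  have hK : K.PosSemidef := by
    have hiff := (RKHS.posSemidef_tfae (K := K)).out 0 2
    refine hiff.mpr ⟨hH, fun c => ?_⟩
    refine (hk c).trans_eq ?_
    simp only [K, Finsupp.sum, RCLike.re_to_real]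
    refine sum_congr rfl fun x _ => sum_congr rfl fun y _ => ?_
    simp [hs x y]
    ring
  have : Fact K.PosSemidef := ⟨hK⟩
  refine ⟨RKHS.OfKernel K, inferInstance, inferInstance, inferInstance,
    fun x => RKHS.kerFun (RKHS.OfKernel K) x 1, fun x y => ?_⟩
  rw [RKHS.kerFun_inner, RKHS.kerFun_apply, RKHS.OfKernel.kernel_ofKernel]
  simp [K]

/-- Schoenberg's criterion: a symmetric kernel vanishing on the diagonal whose Gromov products
at a base point are positive semidefinite is a squared Hilbert distance. -/
lemma exists_hilbert_norm_sub_sq_eq {Y : Type u} (N : Y → Y → ℝ) (o : Y)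
    (hs : ∀ x y, N x y = N y x) (h0 : ∀ x, N x x = 0)
    (hk : ∀ c : Y →₀ ℝ,
      0 ≤ c.sum fun x a => c.sum fun y b => a * b * (N x o + N y o - N x y)) :
    ∃ (H : Type u) (_ : NormedAddCommGroup H) (_ : InnerProductSpace ℝ H)
      (_ : CompleteSpace H) (f : Y → H), ∀ x y, ‖f x - f y‖ ^ 2 = N x y := by
  obtain ⟨H, i1, i2, i3, f, hf⟩ := exists_hilbert_inner_eq
    (fun x y => (N x o + N y o - N x y) / 2) (fun x y => by rw [hs x y]; ring) fun c => by
      refine (div_nonneg (hk c) zero_le_two).trans_eq ?_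
      simp only [Finsupp.sum, Finset.sum_div]
      exact sum_congr rfl fun x _ => sum_congr rfl fun y _ => by ring
  refine ⟨H, i1, i2, i3, f, fun x y => ?_⟩
  rw [norm_sub_sq_real, ← real_inner_self_eq_norm_sq, ← real_inner_self_eq_norm_sq, hf, hf, hf,
    h0, h0]
  ring

/-! ### The cone of kernels of negative type -/

/-- The symmetric kernels on `X` whose Gromov products at `o` are positive semidefinite. -/
def gromovCone {X : Type*} (o : X) : Set (X × X → ℝ) :=
  {N | (∀ x y, N (x, y) = N (y, x)) ∧ ∀ c : X →₀ ℝ,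
    0 ≤ c.sum fun x a => c.sum fun y b => a * b * (N (x, o) + N (y, o) - N (x, y))}

section gromovCone

variable {X : Type*} {o : X}

lemma isClosed_gromovCone : IsClosed (gromovCone o) := by
  simp only [gromovCone, Set.ofPred_and, Set.ofPred_forall, Finsupp.sum]
  refine IsClosed.inter (isClosed_iInter fun x => isClosed_iInter fun y =>
    isClosed_eq (by fun_prop) (by fun_prop)) (isClosed_iInter fun c =>
    isClosed_le (by fun_prop) (by fun_prop))

lemma smul_mem_gromovCone {N : X × X → ℝ} (hN : N ∈ gromovCone o) {t : ℝ} (ht : 0 ≤ t) :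
    t • N ∈ gromovCone o := by
  refine ⟨fun x y => by simp [hN.1 x y], fun c => ?_⟩
  refine (mul_nonneg ht (hN.2 c)).trans_eq ?_
  simp only [Finsupp.sum, Finset.mul_sum, Pi.smul_apply, smul_eq_mul]
  exact sum_congr rfl fun x _ => sum_congr rfl fun y _ => by ring

lemma add_mem_gromovCone {N M : X × X → ℝ} (hN : N ∈ gromovCone o) (hM : M ∈ gromovCone o) :
    N + M ∈ gromovCone o := by
  refine ⟨fun x y => by simp [hN.1 x y, hM.1 x y], fun c => ?_⟩
  refine (add_nonneg (hN.2 c) (hM.2 c)).trans_eq ?_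
  simp only [Finsupp.sum, ← Finset.sum_add_distrib, Pi.add_apply]
  exact sum_congr rfl fun x _ => sum_congr rfl fun y _ => by ring

lemma convex_gromovCone : Convex ℝ (gromovCone o) := fun _ hN _ hM _ _ ha hb _ =>
  add_mem_gromovCone (smul_mem_gromovCone hN ha) (smul_mem_gromovCone hM hb)

/-- The Gromov product is `2 * (v x - v o) * (v y - v o)`, of rank one, so its form is twice a
square. -/
lemma sub_sq_mem_gromovCone (v : X → ℝ) :
    (fun xy : X × X => (v xy.1 - v xy.2) ^ 2) ∈ gromovCone o := by
  refine ⟨fun x y => by ring, fun c => ?_⟩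
  have : (0 : ℝ) ≤ 2 * (c.sum fun x a => a * (v x - v o)) ^ 2 := by positivity
  refine this.trans_eq ?_
  rw [sq, Finsupp.sum, Finset.sum_mul_sum, Finset.mul_sum]
  refine sum_congr rfl fun x _ => ?_
  rw [Finset.mul_sum]
  exact sum_congr rfl fun y _ => by ring

end gromovCone

/-! ### From negative type to embeddings -/

namespace Semimetric

variable {X : Type u} (δ : Semimetric X) {p C : ℝ}

lemma d_self_rpow (hp : 0 < p) (x : X) : δ.d x x ^ p = 0 := by
  rw [(δ.d_eq_zero_iff x x).2 rfl, Real.zero_rpow hp.ne']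

/-- The distorted sum of a matrix, as a sum over all pairs of indices. -/
lemma distorted_sum_eq {n : ℕ} (D : Fin n → Fin n → ℝ) (Q : Matrix (Fin n) (Fin n) ℝ) :
    ∑ ij : Fin n × Fin n with 0 < Q ij.1 ij.2, D ij.1 ij.2 * Q ij.1 ij.2
        + C ^ 2 * ∑ ij : Fin n × Fin n with Q ij.1 ij.2 < 0, D ij.1 ij.2 * Q ij.1 ij.2
      = ∑ i, ∑ j, (if Q i j < 0 then C ^ 2 * D i j else D i j) * Q i j := by
  rw [Finset.sum_filter, Finset.sum_filter, Finset.mul_sum, ← Finset.sum_add_distrib,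
    Fintype.sum_prod_type]
  refine sum_congr rfl fun i _ => sum_congr rfl fun j _ => ?_
  rcases lt_trichotomy (Q i j) 0 with h | h | h
  · simp [h, h.not_gt, mul_assoc]
  · simp [h]
  · simp [h, h.not_gt]

lemma HasNegativeType.sum_nonpos {δ : Semimetric X} (h : δ.HasNegativeType p C) (hp : 0 < p)
    {n : ℕ} {x : Fin n → X} (hx : Function.Injective x) {Q : Matrix (Fin n) (Fin n) ℝ}
    (hQ : Q.PosSemidef) (hQ1 : Q.mulVec (fun _ => 1) = 0) :
    ∑ i, ∑ j, (if Q i j < 0 then C ^ 2 * δ.d (x i) (x j) ^ p else δ.d (x i) (x j) ^ p) * Q i j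
      ≤ 0 := by
  by_cases hn : 2 ≤ n
  · have := h n hn x hx Q hQ hQ1
    rwa [distorted_sum_eq (fun i j => δ.d (x i) (x j) ^ p) Q] at this
  · have hsub : Subsingleton (Fin n) := Fin.subsingleton_iff_le_one.2 (by omega)
    refine (Finset.sum_eq_zero fun i _ => Finset.sum_eq_zero fun j _ => ?_).le
    rw [Subsingleton.elim j i, d_self_rpow δ hp]
    simp

/-- A functional which is nonnegative on squared differences is nonnegative at some kernel
between `d ^ p` and `C ^ 2 * d ^ p`. -/
lemma HasNegativeType.exists_mem_Icc_nonneg {δ : Semimetric X} (h : δ.HasNegativeType p C)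
    (hp : 0 < p) (hC : 1 ≤ C) (φ : StrongDual ℝ (X × X → ℝ))
    (hφ : ∀ v : X → ℝ, 0 ≤ φ fun xy => (v xy.1 - v xy.2) ^ 2) :
    ∃ N ∈ Set.Icc (fun xy : X × X => δ.d xy.1 xy.2 ^ p)
      (fun xy => C ^ 2 * δ.d xy.1 xy.2 ^ p), 0 ≤ φ N := by
  classical
  obtain ⟨S, hS⟩ := StrongDual.exists_finset_sum φ
  let w : X × X → ℝ := fun xy => φ (Pi.single xy 1)
  let T : Finset X := S.image Prod.fst ∪ S.image Prod.snd
  have hST : S ⊆ T ×ˢ T := fun s hs => by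
    simp only [T, mem_product, mem_union, mem_image]
    exact ⟨.inl ⟨s, hs, rfl⟩, .inr ⟨s, hs, rfl⟩⟩
  let x : Fin T.card → X := fun i => (T.equivFin.symm i : X)
  have hx : Function.Injective x := Subtype.val_injective.comp T.equivFin.symm.injective
  have hsumT : ∀ g : X → ℝ, ∑ y ∈ T, g y = ∑ i, g (x i) := fun g => by
    rw [← Finset.sum_coe_sort, ← T.equivFin.symm.sum_comp]
  have hφw : ∀ N, φ N = ∑ i, ∑ j, w (x i, x j) * N (x i, x j) := fun N => by
    rw [hS _ hST, Finset.sum_product, hsumT]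
    exact sum_congr rfl fun i _ => hsumT _
  -- Symmetrising makes the Laplacian symmetric and does not change `φ` on symmetric kernels.
  let a : X → X → ℝ := fun y z => (w (y, z) + w (z, y)) / 2
  have ha : ∀ y z, a y z = a z y := fun y z => by simp only [a]; ring
  have hφa : ∀ N : X × X → ℝ, (∀ y z, N (y, z) = N (z, y)) →
      φ N = ∑ i, ∑ j, a (x i) (x j) * N (x i, x j) := fun N hN => by
    have e : ∑ i, ∑ j, w (x i, x j) * N (x i, x j) = ∑ i, ∑ j, w (x j, x i) * N (x i, x j) := by
      rw [Finset.sum_comm]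
      exact sum_congr rfl fun i _ => sum_congr rfl fun j _ => by rw [hN]
    have e2 : ∑ i, ∑ j, a (x i) (x j) * N (x i, x j)
        = ((∑ i, ∑ j, w (x i, x j) * N (x i, x j))
          + ∑ i, ∑ j, w (x j, x i) * N (x i, x j)) / 2 := by
      simp only [← Finset.sum_add_distrib, Finset.sum_div]
      exact sum_congr rfl fun i _ => sum_congr rfl fun j _ => by simp only [a]; ring
    rw [e2, ← e, hφw]
    ring
  -- The corner of the box adapted to the signs of `a`: since `Q = -a` off the diagonal, `φ N` is
  -- minus the distorted sum of `Q`.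
  let N : X × X → ℝ := fun yz =>
    if 0 < a yz.1 yz.2 then C ^ 2 * δ.d yz.1 yz.2 ^ p else δ.d yz.1 yz.2 ^ p
  have hd : ∀ yz : X × X, δ.d yz.1 yz.2 ^ p ≤ C ^ 2 * δ.d yz.1 yz.2 ^ p := fun yz =>
    le_mul_of_one_le_left (Real.rpow_nonneg (δ.d_nonneg _ _) _) (one_le_pow₀ hC)
  refine ⟨N, ⟨fun yz => ?_, fun yz => ?_⟩, ?_⟩
  · simp only [N]
    split_ifs
    exacts [hd yz, le_rfl]
  · simp only [N]
    split_ifs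
    exacts [le_rfl, hd yz]
  let Q := weightedLaplacian fun i j => a (x i) (x j)
  have hQ : Q.PosSemidef := by
    refine weightedLaplacian_posSemidef (fun i j => ha _ _) fun v => ?_
    have h1 := hφ (Function.extend x v 0)
    rw [hφa _ fun y z => by ring] at h1
    simpa only [hx.extend_apply] using h1
  have hle := h.sum_nonpos hp hx hQ weightedLaplacian_mulVec_one
  rw [hφa N fun y z => by simp only [N, ha y z, δ.d_comm y z]]
  refine (neg_nonneg.2 hle).trans_eq ?_
  simp only [← Finset.sum_neg_distrib]
  refine sum_congr rfl fun i _ => sum_congr rfl fun j _ => ?_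
  by_cases hij : i = j
  · simp [N, hij, d_self_rpow δ hp]
  · simp only [N, Q, weightedLaplacian_of_ne hij, neg_lt_zero]
    ring

/-- Negative type with distortion yields a kernel of negative type between `d ^ p` and
`C ^ 2 * d ^ p`. -/
lemma HasNegativeType.exists_mem_gromovCone {δ : Semimetric X} (h : δ.HasNegativeType p C)
    (hp : 0 < p) (hC : 1 ≤ C) (o : X) :
    ∃ N ∈ gromovCone o, N ∈ Set.Icc (fun xy : X × X => δ.d xy.1 xy.2 ^ p)
      (fun xy => C ^ 2 * δ.d xy.1 xy.2 ^ p) := by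
  by_contra! hdis
  obtain ⟨φ, u, v, hu, huv, hv⟩ := geometric_hahn_banach_compact_closed
    (convex_Icc (𝕜 := ℝ) _ _) isCompact_Icc convex_gromovCone isClosed_gromovCone
    (Set.disjoint_right.2 hdis)
  have hv0 : v < 0 := by
    have h0 : (0 : ℝ) • (fun xy : X × X => ((0 : X → ℝ) xy.1 - (0 : X → ℝ) xy.2) ^ 2)
        ∈ gromovCone o := smul_mem_gromovCone (sub_sq_mem_gromovCone 0) le_rfl
    simpa using hv _ h0
  have hφ : ∀ M ∈ gromovCone o, 0 ≤ φ M := by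
    intro M hM
    by_contra! hneg
    -- Scaling `M` by `v / φ M` brings `φ` exactly to `v`, which the separation forbids on the cone.
    have h1 := hv _ (smul_mem_gromovCone hM (div_nonneg_of_nonpos hv0.le hneg.le))
    rw [map_smul, smul_eq_mul, div_mul_cancel₀ _ hneg.ne] at h1
    exact h1.false
  obtain ⟨N, hN, hN0⟩ := h.exists_mem_Icc_nonneg hp hC φ fun v => hφ _ (sub_sq_mem_gromovCone v)
  linarith [hu N hN]

lemma rpow_half_sq (x y : X) : (δ.d x y ^ (p / 2)) ^ 2 = δ.d x y ^ p := by
  rw [← Real.rpow_mul_natCast (δ.d_nonneg x y)]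
  norm_num

lemma HasNegativeType.embedsInHilbert {δ : Semimetric X} (h : δ.HasNegativeType p C)
    (hp : 0 < p) (hC : 1 ≤ C) :
    EmbedsInHilbert.{u, v} (δ.rpow (p / 2) (half_pos hp)) C := by
  rcases isEmpty_or_nonempty X with hX | ⟨⟨o⟩⟩
  · obtain ⟨H, i1, i2, i3, -⟩ := exists_hilbert_inner_eq (Y := ULift.{v} X) (fun _ _ => 0)
      (fun _ _ => rfl) (by simp)
    exact ⟨H, i1, i2, i3, isEmptyElim, 1, one_pos, isEmptyElim⟩
  obtain ⟨N, ⟨hs, hk⟩, hlo, hhi⟩ := h.exists_mem_gromovCone hp hC o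
  have h0 : ∀ x, N (x, x) = 0 := fun x => by
    have h1 := hlo (x, x)
    have h2 := hhi (x, x)
    simp only [d_self_rpow δ hp, mul_zero] at h1 h2
    exact le_antisymm h2 h1
  obtain ⟨H, i1, i2, i3, f, hf⟩ := exists_hilbert_norm_sub_sq_eq
    (fun x y : ULift.{v} X => N (x.down, y.down)) ⟨o⟩ (fun x y => hs _ _) (fun x => h0 _)
    fun c => by
      have := hk (c.mapDomain ULift.down)
      rw [Finsupp.sum_mapDomain_index_inj ULift.down_injective] at this
      simpa only [Finsupp.sum_mapDomain_index_inj ULift.down_injective] using this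
  refine ⟨H, i1, i2, i3, fun x => f ⟨x⟩, 1, one_pos, fun x y => ?_⟩
  have hN := hf ⟨x⟩ ⟨y⟩
  have h1 : δ.d x y ^ p ≤ N (x, y) := hlo (x, y)
  have h2 : N (x, y) ≤ C ^ 2 * δ.d x y ^ p := hhi (x, y)
  have hd : 0 ≤ δ.d x y ^ (p / 2) := Real.rpow_nonneg (δ.d_nonneg x y) _
  simp only [ofMetricSpace, rpow, dist_eq_norm, one_mul]
  rw [← rpow_half_sq] at h1 h2
  rw [← mul_pow] at h2
  exact ⟨le_of_sq_le_sq (h1.trans_eq hN.symm) (norm_nonneg _),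
    le_of_sq_le_sq (hN.trans_le h2) (by positivity)⟩

/-! ### From embeddings to negative type -/

/-- For `Q` positive semidefinite with zero row sums, `∑ Q i j * ‖g i - g j‖ ^ 2 ≤ 0`. -/
lemma sum_norm_sub_sq_mul_nonpos {H : Type*} [NormedAddCommGroup H] [InnerProductSpace ℝ H]
    {ι : Type*} [Fintype ι] {Q : Matrix ι ι ℝ} (hQ : Q.PosSemidef)
    (hQ1 : Q.mulVec (fun _ => 1) = 0) (g : ι → H) :
    ∑ i, ∑ j, ‖g i - g j‖ ^ 2 * Q i j ≤ 0 := by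
  have hrow : ∀ i, ∑ j, Q i j = 0 := fun i => by
    simpa [Matrix.mulVec, dotProduct] using congrFun hQ1 i
  have hcol : ∀ j, ∑ i, Q i j = 0 := fun j => by
    rw [← hrow j]
    exact sum_congr rfl fun i _ => by simpa using hQ.1.apply j i
  have hgram : 0 ≤ ∑ i, ∑ j, Q i j * inner ℝ (g i) (g j) := by
    -- With `Q` a sum of rank-one terms `w k (w k)ᵀ`, the Gram sum becomes a sum of squared norms.
    obtain ⟨m, w, rfl⟩ := Matrix.posSemidef_iff_eq_sum_vecMulVec.1 hQ
    have : 0 ≤ ∑ k, ‖∑ i, w k i • g i‖ ^ 2 := by positivity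
    refine this.trans_eq ?_
    simp only [← real_inner_self_eq_norm_sq, sum_inner, inner_sum, real_inner_smul_left,
      real_inner_smul_right, Matrix.sum_apply, Matrix.vecMulVec_apply, Finset.sum_mul]
    rw [Finset.sum_comm]
    refine sum_congr rfl fun i _ => ?_
    rw [Finset.sum_comm]
    exact sum_congr rfl fun j _ => sum_congr rfl fun k _ => by
      rw [real_inner_comm, Pi.star_apply, star_trivial]; ring
  have e : ∑ i, ∑ j, ‖g i - g j‖ ^ 2 * Q i j = (∑ i, ∑ j, ‖g i‖ ^ 2 * Q i j)
      + (∑ i, ∑ j, ‖g j‖ ^ 2 * Q i j) - 2 * ∑ i, ∑ j, Q i j * inner ℝ (g i) (g j) := by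
    simp only [Finset.mul_sum, ← Finset.sum_add_distrib, ← Finset.sum_sub_distrib]
    exact sum_congr rfl fun i _ => sum_congr rfl fun j _ => by rw [norm_sub_sq_real]; ring
  have e1 : ∑ i, ∑ j, ‖g i‖ ^ 2 * Q i j = 0 := by
    simp [← Finset.mul_sum, hrow]
  have e2 : ∑ i, ∑ j, ‖g j‖ ^ 2 * Q i j = 0 := by
    rw [Finset.sum_comm]
    simp [← Finset.mul_sum, hcol]
  rw [e, e1, e2]
  linarith

lemma EmbedsInHilbert.hasNegativeType {δ : Semimetric X} (hp : 0 < p)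
    (h : EmbedsInHilbert.{u, v} (δ.rpow (p / 2) (half_pos hp)) C) : δ.HasNegativeType p C := by
  obtain ⟨H, _, _, _, f, s, hs, hf⟩ := h
  intro n _ x _ Q hQ hQ1
  rw [distorted_sum_eq (fun i j => δ.d (x i) (x j) ^ p) Q]
  have hle := sum_norm_sub_sq_mul_nonpos hQ hQ1 fun i => f (x i)
  refine nonpos_of_mul_nonpos_right (le_trans ?_ hle) (pow_pos hs 2)
  rw [Finset.mul_sum]
  refine sum_le_sum fun i _ => ?_
  rw [Finset.mul_sum]
  refine sum_le_sum fun j _ => ?_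
  obtain ⟨h1, h2⟩ := hf (x i) (x j)
  simp only [ofMetricSpace, rpow, dist_eq_norm] at h1 h2
  have hd : 0 ≤ δ.d (x i) (x j) ^ (p / 2) := Real.rpow_nonneg (δ.d_nonneg _ _) _
  rw [← mul_assoc, ← rpow_half_sq]
  split_ifs with hq
  -- Negative entries reverse inequalities, so they use the upper distortion bound; the others use
  -- the lower one.
  · refine mul_le_mul_of_nonpos_right ?_ hq.le
    refine (pow_le_pow_left₀ (norm_nonneg _) h2 2).trans_eq (by ring)
  · refine mul_le_mul_of_nonneg_right ?_ (not_lt.1 hq)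
    refine Eq.trans_le (by ring) (pow_le_pow_left₀ (by positivity) h1 2)

end Semimetric

theorem theorem2p3 {X : Type u} (δ : Semimetric X) (p C : ℝ) (hp : 0 < p) (hC : 1 ≤ C) :
    δ.HasNegativeType p C ↔
      Semimetric.EmbedsInHilbert.{u, v} (δ.rpow (p / 2) (half_pos hp)) C :=
  ⟨fun h => h.embedsInHilbert hp hC, fun h => h.hasNegativeType hp⟩
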